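/- Let $G$ be a compact (Hausdorff) group with identity $e$ and normalized Haar measure $\nu$ (so $\nu(G)=1$), and let $A\subseteq G$ be any subset, with complement $A^c = G\setminus A$. Call a continuous function $f:G\to\mathbb{C}$ positive definite if $\sum_{i,j=1}^n \overline{c_i}\,f(g_i^{-1}g_j)\,c_j\ge 0$ for all $n\ge 1$, $g_1,\dots,g_n\in G$ and $c_1,\dots,c_n\in\mathbb{C}$. Define $$B(G,A) := \inf\Big\{\, h(e) \;:\; h:G\to\mathbb{R} \text{ continuous and positive definite},\ h(g)\le 0 \text{ for all } g\in A^c,\ \int_G h\,d\nu = 1 \Big\},$$ with $B(G,A)=+\infty$ if no such $h$ exists. Let $\mu$ be a Radon probability measure on $G$ with $\mathrm{supp}(\mu)\subseteq\overline{A^c}$, and let $c>0$ be such that, for every (finite-dimensional, continuous) irreducible unitary representation $\pi$ of $G$, the Fourier transform $\widehat\mu(\pi):=\int_G\pi(g)\,d\mu(g)$ satisfies $\widehat\mu(\pi)\succeq -c\,I$, that is, $\widehat\mu(\pi)+c\,I$ is Hermitian and positive semidefinite. Then $$B(G,A)\ \ge\ 1+\frac1c .$$ -/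

import Mathlib

open MeasureTheory
open scoped ComplexOrder

/-- A continuous function `f : G → ℂ` is positive definite if
`∑ i j, conj (c i) * f ((g i)⁻¹ * g j) * c j ≥ 0` for all finite families `g` in `G` and `c` in `ℂ`.
Here `0 ≤ z` for complex `z` means that `z` is real and nonnegative. -/
def IsPositiveDefiniteFun {G : Type*} [Group G] [TopologicalSpace G] (f : G → ℂ) : Prop :=
  Continuous f ∧ ∀ (n : ℕ) (g : Fin n → G) (c : Fin n → ℂ),
    0 ≤ ∑ i, ∑ j, star (c i) * f ((g i)⁻¹ * g j) * c j

/-- The Haar measure of a compact group, normalized to have total mass one. -/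
noncomputable def normalizedHaar (G : Type*) [Group G] [TopologicalSpace G]
    [IsTopologicalGroup G] [CompactSpace G] [MeasurableSpace G] [BorelSpace G] : Measure G :=
  Measure.haarMeasure (⊤ : TopologicalSpace.PositiveCompacts G)

/-- The feasible functions: real-valued positive definite functions (in particular continuous),
nonpositive off `A`, with Haar integral one. -/
def packingFeasible (G : Type*) [Group G] [TopologicalSpace G]
    [IsTopologicalGroup G] [CompactSpace G] [MeasurableSpace G] [BorelSpace G]
    (A : Set G) : Set (G → ℝ) :=
  {h | IsPositiveDefiniteFun (fun g => (h g : ℂ)) ∧ (∀ g ∈ Aᶜ, h g ≤ 0) ∧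
    ∫ g, h g ∂(normalizedHaar G) = 1}

/-- The positive definite function bound `B(G, A)`: the infimum of `h(e)` over feasible `h`,
in the extended reals, so that it is `+∞` when nothing is feasible. -/
noncomputable def packingBound (G : Type*) [Group G] [TopologicalSpace G]
    [IsTopologicalGroup G] [CompactSpace G] [MeasurableSpace G] [BorelSpace G]
    (A : Set G) : EReal :=
  ⨅ h ∈ packingFeasible G A, (h 1 : EReal)

/-- The linear representation on `ℂⁿ` afforded by a homomorphism into the unitary matrices. -/
noncomputable def unitaryMatrixRep {G : Type*} [Group G] {n : ℕ}
    (π : G →* Matrix.unitaryGroup (Fin n) ℂ) : Representation ℂ G (Fin n → ℂ) :=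
  ((Matrix.toLinAlgEquiv' : Matrix (Fin n) (Fin n) ℂ ≃ₐ[ℂ] _) :
    Matrix (Fin n) (Fin n) ℂ →* ((Fin n → ℂ) →ₗ[ℂ] (Fin n → ℂ))).comp
    ((Matrix.unitaryGroup (Fin n) ℂ).subtype.comp π)

/-- A unitary irrep of `G` of dimension `n`, written in an orthonormal basis: a continuous
homomorphism `π` into the unitary group of `ℂⁿ` such that `ℂⁿ` is nonzero and has no
`π`-invariant subspaces other than `0` and itself. -/
def IsUnitaryIrrep {G : Type*} [Group G] [TopologicalSpace G] {n : ℕ}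
    (π : G →* Matrix.unitaryGroup (Fin n) ℂ) : Prop :=
  Continuous π ∧ (unitaryMatrixRep π).IsIrreducible

/-- The Fourier transform `∫ π(g) dμ(g)` of a measure at `π`, as a matrix of integrals. -/
noncomputable def measureFourier {G : Type*} [Group G] [MeasurableSpace G] (μ : Measure G)
    {n : ℕ} (π : G →* Matrix.unitaryGroup (Fin n) ℂ) : Matrix (Fin n) (Fin n) ℂ :=
  Matrix.of fun i j => ∫ g, (π g : Matrix (Fin n) (Fin n) ℂ) i j ∂μ

/-! Weak duality: integrate a feasible `h` against `μ`. Since `μ` lives on the closure of `Aᶜ`,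
where `h ≤ 0`, the integral is at most 0. It remains to show `∫ h dμ ≥ 1 - c (h 1 - 1)`
(`integral_ge_of_isPositiveDefiniteFun`).

By GNS, `h g = ⟪v, U g v⟫` for a cyclic unitary representation. The Haar average `e` of the orbit of
`v` is the invariant part of `v`, and `∫ h dν = 1` gives `‖e‖ = 1`, so `v - e` has matrix
coefficient `h - 1`. The Fourier bound says that the operator `∫ U g dμ` is at least `-c`; evaluated
at `v - e`, this is the inequality. Splitting off `e` matters: there the operator acts as 1, not
merely as something above `-c`.

The hypothesis only concerns irreducibles. It passes to finite-dimensional invariant subspaces by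
orthogonal splitting, then to all of `H` by density, a Peter–Weyl argument using the eigenspaces of
a compact operator commuting with `U`. -/

/-! ### Finite-dimensional invariant subspaces as matrix representations. -/

/-- The matrix of a unitary operator on an invariant subspace, in an orthonormal basis. -/
noncomputable def subrepMatrix {G H : Type*} [Group G] [NormedAddCommGroup H]
    [InnerProductSpace ℂ H] (U : G →* (H →ₗᵢ[ℂ] H)) (W : Submodule ℂ H)
    (hW : ∀ g, ∀ w ∈ W, U g w ∈ W) {n : ℕ} (b : OrthonormalBasis (Fin n) ℂ W) :
    G →* Matrix.unitaryGroup (Fin n) ℂ where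
  toFun g := ⟨LinearMap.toMatrix b.toBasis b.toBasis ((U g).toLinearMap.restrict (hW g)), by
    rw [Matrix.mem_unitaryGroup_iff']
    ext i j
    have h1 : ∀ i, (((U g).toLinearMap.restrict (hW g)) (b i) : H) = U g (b i) := fun i => rfl
    have h2 : inner ℂ (((U g).toLinearMap.restrict (hW g)) (b i))
        (((U g).toLinearMap.restrict (hW g)) (b j)) = (1 : Matrix (Fin n) (Fin n) ℂ) i j := by
      rw [Submodule.coe_inner, h1, h1, LinearIsometry.inner_map_map, ← Submodule.coe_inner,
        b.inner_eq_ite, Matrix.one_apply]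
    rw [← h2, ← b.sum_inner_mul_inner, Matrix.mul_apply]
    refine Finset.sum_congr rfl fun k _ => ?_
    simp [LinearMap.toMatrix_apply, Matrix.star_apply, OrthonormalBasis.repr_apply_apply]⟩
  map_one' := by
    have : ((U 1).toLinearMap.restrict (hW 1)) = LinearMap.id := by ext; simp
    refine Subtype.ext ?_
    change LinearMap.toMatrix b.toBasis b.toBasis ((U 1).toLinearMap.restrict (hW 1)) = 1
    rw [this, LinearMap.toMatrix_id]
  map_mul' x y := by
    ext1
    have : ((U (x * y)).toLinearMap.restrict (hW (x * y))) =
      ((U x).toLinearMap.restrict (hW x)) ∘ₗ ((U y).toLinearMap.restrict (hW y)) := by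
      ext; simp
    simp only [this, LinearMap.toMatrix_comp b.toBasis b.toBasis b.toBasis]
    rfl

section
variable {G H : Type*} [Group G] [NormedAddCommGroup H]
    [InnerProductSpace ℂ H] (U : G →* (H →ₗᵢ[ℂ] H)) (W : Submodule ℂ H)
    (hW : ∀ g, ∀ w ∈ W, U g w ∈ W) {n : ℕ} (b : OrthonormalBasis (Fin n) ℂ W)

theorem subrepMatrix_apply (g : G) (i j : Fin n) :
    (subrepMatrix U W hW b g : Matrix (Fin n) (Fin n) ℂ) i j
      = inner ℂ (b i : H) (U g (b j)) := by
  simp only [subrepMatrix, MonoidHom.coe_mk, OneHom.coe_mk, LinearMap.toMatrix_apply,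
    OrthonormalBasis.coe_toBasis, OrthonormalBasis.coe_toBasis_repr_apply,
    OrthonormalBasis.repr_apply_apply, Submodule.coe_inner]
  rfl

theorem continuous_subrepMatrix [TopologicalSpace G] (hc : ∀ x, Continuous fun g => U g x) :
    Continuous (subrepMatrix U W hW b) := by
  refine Continuous.subtype_mk (continuous_matrix fun i j => ?_) _
  have h : Continuous fun g => inner ℂ (b i : H) (U g (b j)) := continuous_const.inner (hc (b j))
  simp only [← subrepMatrix_apply U W hW b] at h
  exact h

theorem sum_unitaryMatrixRep_subrepMatrix (g : G) (x : Fin n → ℂ) :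
    ∑ i, (unitaryMatrixRep (subrepMatrix U W hW b) g x) i • (b i : H)
      = U g (∑ i, x i • (b i : H)) := by
  have key : ∀ j, ∑ i, inner ℂ (b i : H) (U g (b j)) • (b i : H) = U g (b j) := by
    intro j
    have := congrArg Subtype.val (b.sum_repr' ⟨U g (b j), hW g _ (b j).2⟩)
    simpa using this
  symm
  rw [map_sum, Finset.sum_congr rfl fun j _ => by rw [map_smul, ← key j, Finset.smul_sum],
    Finset.sum_comm]
  simp only [smul_smul]
  refine Finset.sum_congr rfl fun i _ => ?_
  rw [← Finset.sum_smul]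
  congr 1
  simp only [unitaryMatrixRep, MonoidHom.coe_comp, Function.comp_apply, MonoidHom.coe_coe,
    Submonoid.coe_subtype, Matrix.toLinAlgEquiv'_apply, Matrix.mulVec, dotProduct]
  simp only [subrepMatrix_apply, mul_comm]

/-- The coordinate map `φ` of the basis is an injective intertwiner with range `W`, so
subrepresentations of `ℂⁿ` correspond to invariant subspaces of `W`. -/
theorem isIrreducible_subrepMatrix (hne : W ≠ ⊥)
    (hirr : ∀ W' ≤ W, (∀ g, ∀ w ∈ W', U g w ∈ W') → W' = ⊥ ∨ W' = W) :
    (unitaryMatrixRep (subrepMatrix U W hW b)).IsIrreducible := by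
  let φ : (Fin n → ℂ) →ₗ[ℂ] H := Fintype.linearCombination ℂ (fun i => (b i : H))
  have hφ : ∀ x, φ x = ∑ i, x i • (b i : H) := fun x => Fintype.linearCombination_apply ..
  have hφU : ∀ g x, φ (unitaryMatrixRep (subrepMatrix U W hW b) g x) = U g (φ x) := by
    intro g x
    rw [hφ, hφ, sum_unitaryMatrixRep_subrepMatrix]
  have hφi : Function.Injective φ := by
    have h := b.toBasis.linearIndependent.map' W.subtype W.ker_subtype
    rw [← LinearMap.ker_eq_bot, LinearMap.ker_eq_bot']
    intro x hx
    rw [hφ] at hx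
    exact funext (Fintype.linearIndependent_iff.1 h x (by simpa using hx))
  have hφr : LinearMap.range φ = W := by
    rw [Fintype.range_linearCombination]
    have h := b.toBasis.span_eq
    have h2 := congrArg (Submodule.map W.subtype) h
    rw [Submodule.map_span, Submodule.map_top, Submodule.range_subtype, ← Set.range_comp] at h2
    convert h2 using 3
    ext; simp
  have hcases : ∀ S : Subrepresentation (unitaryMatrixRep (subrepMatrix U W hW b)),
      S.toSubmodule = ⊥ ∨ S.toSubmodule = ⊤ := by
    intro S
    rcases hirr (S.toSubmodule.map φ) (LinearMap.map_le_range.trans hφr.le) (by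
      rintro g _ ⟨x, hx, rfl⟩
      exact ⟨_, S.apply_mem_toSubmodule g hx, hφU g x⟩) with h | h
    · left
      exact Submodule.map_injective_of_injective hφi (h.trans (Submodule.map_bot φ).symm)
    · right
      exact Submodule.map_injective_of_injective hφi
        (h.trans (hφr.symm.trans (LinearMap.range_eq_map φ)))
  have hnt : (⊥ : Submodule ℂ (Fin n → ℂ)) ≠ ⊤ := by
    intro h
    apply hne
    exact hφr.symm.trans (by rw [LinearMap.range_eq_map, ← h, Submodule.map_bot])
  refine { exists_pair_ne := ⟨⊥, ⊤, fun h => hnt ?_⟩, eq_bot_or_eq_top := fun S => ?_ }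
  · exact congrArg Subrepresentation.toSubmodule h
  · exact (hcases S).imp (fun h => Subrepresentation.toSubmodule_injective h)
      (fun h => Subrepresentation.toSubmodule_injective h)

end

/-! ### The Fourier bound on finite-dimensional invariant subspaces. -/

theorem Continuous.integrable_of_compactSpace {X E : Type*} [TopologicalSpace X] [CompactSpace X]
    [MeasurableSpace X] [BorelSpace X] {μ : Measure X} [IsFiniteMeasure μ]
    [NormedAddCommGroup E] {f : X → E} (hf : Continuous f) : Integrable f μ :=
  hf.integrable_of_hasCompactSupport (HasCompactSupport.of_compactSpace f)

theorem map_map_inv_apply {G H : Type*} [Group G] [NormedAddCommGroup H]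
    [InnerProductSpace ℂ H] (U : G →* (H →ₗᵢ[ℂ] H)) (g : G) (x : H) : U g (U g⁻¹ x) = x := by
  have h : (U g * U g⁻¹) x = x := by rw [← map_mul, mul_inv_cancel, map_one]; rfl
  exact h

section
variable {G H : Type*} [Group G] [TopologicalSpace G] [CompactSpace G]
    [MeasurableSpace G] [BorelSpace G] {μ : Measure G} [IsFiniteMeasure μ]

variable [NormedAddCommGroup H] [InnerProductSpace ℂ H] {U : G →* (H →ₗᵢ[ℂ] H)}
    (hU : ∀ x, Continuous fun g => U g x)
include hU

theorem integrable_inner_apply (x y : H) : Integrable (fun g => inner ℂ x (U g y)) μ :=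
  (continuous_const.inner (hU y)).integrable_of_compactSpace

theorem integrable_re_inner_apply (x y : H) :
    Integrable (fun g => (inner ℂ x (U g y)).re) μ :=
  (integrable_inner_apply hU x y).re

theorem integral_re_inner_add_nonneg_of_posSemidef {c : ℝ} {W : Submodule ℂ H}
    {hW : ∀ g, ∀ w ∈ W, U g w ∈ W} {n : ℕ} (b : OrthonormalBasis (Fin n) ℂ W)
    (h : (measureFourier μ (subrepMatrix U W hW b)
      - (-(c : ℂ)) • (1 : Matrix (Fin n) (Fin n) ℂ)).PosSemidef) {w : H} (hw : w ∈ W) :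
    0 ≤ ∫ g, (inner ℂ w (U g w)).re ∂μ + c * ‖w‖ ^ 2 := by
  set x : Fin n → ℂ := fun i => inner ℂ (b i : H) w with hx
  have hwx : w = ∑ i, x i • (b i : H) := by
    have := congrArg Subtype.val (b.sum_repr' ⟨w, hw⟩)
    simpa using this.symm
  have hinner : ∀ v, inner ℂ w v = ∑ i, star (x i) * inner ℂ (b i : H) v := fun v => by
    conv_lhs => rw [hwx, sum_inner]
    simp
  have hU' : ∀ g, inner ℂ w (U g w)
      = ∑ i, ∑ j, star (x i) * (inner ℂ (b i : H) (U g (b j)) * x j) := fun g => by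
    rw [hinner]
    refine Finset.sum_congr rfl fun i _ => ?_
    conv_lhs => rw [hwx, map_sum, inner_sum]
    simp [Finset.mul_sum, mul_comm]
  have hn : ((‖w‖ ^ 2 : ℝ) : ℂ) = ∑ i, star (x i) * x i := by
    rw [← hinner, inner_self_eq_norm_sq_to_K]; simp
  have hint : ∫ g, inner ℂ w (U g w) ∂μ
      = ∑ i, ∑ j, star (x i) * ((∫ g, inner ℂ (b i : H) (U g (b j)) ∂μ) * x j) := by
    simp only [hU']
    have hi : ∀ i j, Integrable
        (fun g => star (x i) * (inner ℂ (b i : H) (U g (b j)) * x j)) μ := fun i j =>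
      ((integrable_inner_apply hU _ _).mul_const _).const_mul _
    rw [integral_finsetSum _ fun i _ => integrable_finsetSum _ fun j _ => hi i j]
    refine Finset.sum_congr rfl fun i _ => ?_
    rw [integral_finsetSum _ fun j _ => hi i j]
    refine Finset.sum_congr rfl fun j _ => ?_
    rw [integral_const_mul, integral_mul_const]
  have key : star x ⬝ᵥ ((measureFourier μ (subrepMatrix U W hW b)
      - (-(c : ℂ)) • (1 : Matrix (Fin n) (Fin n) ℂ)).mulVec x)
      = ∫ g, inner ℂ w (U g w) ∂μ + c * (‖w‖ ^ 2 : ℝ) := by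
    rw [Matrix.sub_mulVec, dotProduct_sub, Matrix.smul_mulVec, Matrix.one_mulVec, dotProduct_smul,
      hn, hint]
    simp only [dotProduct, Matrix.mulVec, measureFourier, Matrix.of_apply, subrepMatrix_apply,
      Pi.star_apply, Finset.mul_sum, smul_eq_mul, neg_mul, sub_neg_eq_add, Finset.sum_neg_distrib]
  have h0 := (Complex.le_def.1 (h.dotProduct_mulVec_nonneg x)).1
  rw [key, Complex.add_re, Complex.re_ofReal_mul, Complex.ofReal_re] at h0
  have hre : (∫ g, inner ℂ w (U g w) ∂μ).re = ∫ g, (inner ℂ w (U g w)).re ∂μ :=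
    (integral_re (integrable_inner_apply hU w w)).symm
  rwa [hre] at h0

/-- Complete reducibility by strong induction on dimension: both sides of the bound are additive
over an orthogonal splitting into invariant subspaces. -/
theorem integral_re_inner_add_nonneg_of_finiteDimensional {c : ℝ}
    (hμ : ∀ (n : ℕ) (π : G →* Matrix.unitaryGroup (Fin n) ℂ), IsUnitaryIrrep π →
      (measureFourier μ π - (-(c : ℂ)) • (1 : Matrix (Fin n) (Fin n) ℂ)).PosSemidef)
    (W : Submodule ℂ H) [FiniteDimensional ℂ W] (hW : ∀ g, ∀ w ∈ W, U g w ∈ W) {w : H}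
    (hw : w ∈ W) : 0 ≤ ∫ g, (inner ℂ w (U g w)).re ∂μ + c * ‖w‖ ^ 2 := by
  induction hn : Module.finrank ℂ W using Nat.strong_induction_on generalizing W w with
  | _ n ih =>
  by_cases hbot : W = ⊥
  · subst hbot
    rw [Submodule.mem_bot] at hw
    simp [hw]
  by_cases hirr : ∀ W' ≤ W, (∀ g, ∀ w ∈ W', U g w ∈ W') → W' = ⊥ ∨ W' = W
  · exact integral_re_inner_add_nonneg_of_posSemidef hU (stdOrthonormalBasis ℂ W)
      (hμ _ _ ⟨continuous_subrepMatrix U W hW _ hU, isIrreducible_subrepMatrix U W hW _ hbot hirr⟩)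
      hw
  push Not at hirr
  obtain ⟨W', hle, hinv, hb, ht⟩ := hirr
  have : FiniteDimensional ℂ W' := Submodule.finiteDimensional_of_le hle
  have hinv2 : ∀ g, ∀ w ∈ W'ᗮ ⊓ W, U g w ∈ W'ᗮ ⊓ W := by
    rintro g w ⟨h1, h2⟩
    refine ⟨fun u hu => ?_, hW g w h2⟩
    -- Writing `u = U g (U g⁻¹ u)` moves the action onto `W'`, which is invariant under `g⁻¹`.
    rw [← map_map_inv_apply U g u, LinearIsometry.inner_map_map]
    exact h1 _ (hinv _ _ hu)
  have : FiniteDimensional ℂ (W'ᗮ ⊓ W : Submodule ℂ H) :=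
    Submodule.finiteDimensional_of_le inf_le_right
  have hsum := Submodule.finrank_add_inf_finrank_orthogonal hle
  have hpos : 0 < Module.finrank ℂ W' := by
    rw [Module.finrank_pos_iff, Submodule.nontrivial_iff_ne_bot]; exact hb
  have hlt : Module.finrank ℂ W' < Module.finrank ℂ W :=
    Submodule.finrank_lt_finrank_of_lt (lt_of_le_of_ne hle ht)
  set u := W'.starProjection w with hu
  have hu1 : u ∈ W' := Submodule.starProjection_apply_mem W' w
  have hv1 : w - u ∈ W'ᗮ ⊓ W :=
    ⟨Submodule.sub_starProjection_mem_orthogonal w, W.sub_mem hw (hle hu1)⟩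
  have e1 := ih _ (hn ▸ hlt) W' hinv hu1 rfl
  have e2 := ih _ (by omega) (W'ᗮ ⊓ W) hinv2 hv1 rfl
  obtain ⟨v, hv⟩ : ∃ v, v = w - u := ⟨_, rfl⟩
  rw [← hv] at e2 hv1
  have hwuv : w = u + v := by rw [hv]; abel
  have hnorm : ‖w‖ ^ 2 = ‖u‖ ^ 2 + ‖v‖ ^ 2 := by
    rw [hwuv, sq, sq, sq]
    exact norm_add_sq_eq_norm_sq_add_norm_sq_of_inner_eq_zero _ _ (hv1.1 u hu1)
  have hin : ∀ g, (inner ℂ w (U g w)).re = (inner ℂ u (U g u)).re + (inner ℂ v (U g v)).re := by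
    intro g
    have h1 : inner ℂ u (U g v) = 0 := (hinv2 g v hv1).1 u hu1
    have h2 : inner ℂ v (U g u) = 0 := inner_eq_zero_symm.1 (hv1.1 _ (hinv g u hu1))
    rw [hwuv, map_add, inner_add_left, inner_add_right, inner_add_right, h1, h2]
    simp
  simp only [hin]
  rw [integral_add (integrable_re_inner_apply hU u u) (integrable_re_inner_apply hU v v), hnorm]
  linarith

/-- Dominated convergence; near `w₀` the integrand is bounded by `(‖w₀‖ + 1) ^ 2` uniformly in `g`.
This lets the bound pass from a dense set to all vectors. -/
theorem continuous_integral_re_inner :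
    Continuous fun w => ∫ g, (inner ℂ w (U g w)).re ∂μ := by
  rw [continuous_iff_continuousAt]
  intro w₀
  refine continuousAt_of_dominated (bound := fun _ => (‖w₀‖ + 1) ^ 2)
    (.of_forall fun w => (integrable_re_inner_apply hU w w).aestronglyMeasurable) ?_
    (integrable_const _) (.of_forall fun g => by
      refine Continuous.continuousAt ?_
      exact Complex.continuous_re.comp (continuous_id.inner (U g).continuous))
  have hb : ∀ᶠ w in nhds w₀, ‖w‖ < ‖w₀‖ + 1 :=
    continuous_norm.continuousAt.eventually_lt_const (lt_add_one _)
  filter_upwards [hb] with w hw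
  refine .of_forall fun g => ?_
  calc ‖(inner ℂ w (U g w)).re‖ ≤ ‖inner ℂ w (U g w)‖ := Complex.abs_re_le_norm _
    _ ≤ ‖w‖ * ‖U g w‖ := norm_inner_le_norm _ _
    _ = ‖w‖ ^ 2 := by rw [LinearIsometry.norm_map, sq]
    _ ≤ _ := by gcongr

end

/-! ### Peter–Weyl density through an averaged compact operator. -/

theorem continuous_rankOne_self {X H : Type*} [TopologicalSpace X] [NormedAddCommGroup H]
    [InnerProductSpace ℂ H] {φ : X → H} (hφ : Continuous φ) :
    Continuous fun x => InnerProductSpace.rankOne ℂ (φ x) (φ x) :=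
  ((ContinuousLinearMap.smulRightL ℂ H H).continuous.comp
    ((innerSL ℂ).continuous.comp hφ)).clm_apply hφ

section
variable {G H : Type*} [Group G] [TopologicalSpace G] [IsTopologicalGroup G] [CompactSpace G]
    [MeasurableSpace G] [BorelSpace G]

theorem isHaarMeasure_normalizedHaar : (normalizedHaar G).IsHaarMeasure := by
  unfold normalizedHaar; infer_instance

theorem isProbabilityMeasure_normalizedHaar : IsProbabilityMeasure (normalizedHaar G) :=
  ⟨Measure.haarMeasure_self⟩

theorem isMulLeftInvariant_normalizedHaar : (normalizedHaar G).IsMulLeftInvariant := by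
  unfold normalizedHaar; infer_instance

attribute [local instance] isProbabilityMeasure_normalizedHaar isMulLeftInvariant_normalizedHaar

variable [NormedAddCommGroup H] [InnerProductSpace ℂ H] {U : G →* (H →ₗᵢ[ℂ] H)}
    (hU : ∀ x, Continuous fun g => U g x)

variable (U) in
/-- The Haar average of the rank-one operators attached to the orbit of a vector. -/
noncomputable def averagedRankOne (v : H) : H →L[ℂ] H :=
  ∫ g, InnerProductSpace.rankOne ℂ (U g v) (U g v) ∂(normalizedHaar G)

include hU

theorem averagedRankOne_apply (v y : H) :
    averagedRankOne U v y = ∫ g, inner ℂ (U g v) y • U g v ∂(normalizedHaar G) := by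
  rw [averagedRankOne, ContinuousLinearMap.integral_apply
    (continuous_rankOne_self (hU v)).integrable_of_compactSpace]
  rfl

theorem integrable_inner_smul_orbit (v y : H) :
    Integrable (fun g => inner ℂ (U g v) y • U g v) (normalizedHaar G) :=
  (((hU v).inner continuous_const).smul (hU v)).integrable_of_compactSpace

variable [CompleteSpace H]

theorem inner_averagedRankOne (v x y : H) :
    inner ℂ x (averagedRankOne U v y)
      = ∫ g, inner ℂ (U g v) y * inner ℂ x (U g v) ∂(normalizedHaar G) := by
  rw [averagedRankOne_apply hU, ← integral_inner (integrable_inner_smul_orbit hU v y)]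
  simp only [inner_smul_right]

/-- Compact operators form a closed convex set, so a norm-convergent average of rank-one operators
stays in it. -/
theorem isCompactOperator_averagedRankOne (v : H) : IsCompactOperator (averagedRankOne U v) := by
  have hcl : IsClosed ((compactOperator (RingHom.id ℂ) H H : Submodule ℂ (H →L[ℂ] H)) :
      Set (H →L[ℂ] H)) := isClosed_setOfPred_isCompactOperator
  refine Convex.integral_mem (E := H →L[ℂ] H)
    (s := (compactOperator (RingHom.id ℂ) H H : Submodule ℂ (H →L[ℂ] H)))
    ((compactOperator (RingHom.id ℂ) H H).restrictScalars ℝ).convex hcl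
    (.of_forall fun g => ?_) (continuous_rankOne_self (hU v)).integrable_of_compactSpace
  change IsCompactOperator (InnerProductSpace.rankOne ℂ (U g v) (U g v))
  rw [InnerProductSpace.rankOne_def']
  exact (isCompactOperator_of_locallyCompactSpace_rng
    (ContinuousLinearMap.toSpanSingleton ℂ (U g v))).comp_clm _

theorem isSymmetric_averagedRankOne (v : H) :
    (averagedRankOne U v : H →ₗ[ℂ] H).IsSymmetric := by
  intro x y
  change inner ℂ (averagedRankOne U v x) y = inner ℂ x (averagedRankOne U v y)
  rw [← inner_conj_symm, inner_averagedRankOne hU, inner_averagedRankOne hU, ← integral_conj]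
  congr 1
  ext g
  rw [map_mul, inner_conj_symm, inner_conj_symm, mul_comm]

theorem averagedRankOne_map (v : H) (x : G) (y : H) :
    averagedRankOne U v (U x y) = U x (averagedRankOne U v y) := by
  rw [averagedRankOne_apply hU, averagedRankOne_apply hU, ← integral_mul_left_eq_self _ x]
  have := (U x).toContinuousLinearMap.integral_comp_comm (integrable_inner_smul_orbit hU v y)
  refine Eq.trans ?_ this
  congr 1
  ext g
  simp [LinearIsometry.inner_map_map]

/-- `⟪y, T y⟫` is the Haar integral of the continuous function `‖⟪U g v, y⟫‖ ^ 2`. If it vanishes,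
`y` is orthogonal to the orbit of `v`, which is total. -/
theorem eq_zero_of_averagedRankOne_eq_zero {v y : H}
    (hv : (Submodule.span ℂ (Set.range fun g => U g v)).topologicalClosure = ⊤)
    (hy : averagedRankOne U v y = 0) : y = 0 := by
  have : (normalizedHaar G).IsHaarMeasure := isHaarMeasure_normalizedHaar
  have hcont : Continuous fun g => ‖inner ℂ (U g v) y‖ ^ 2 :=
    ((hU v).inner continuous_const).norm.pow 2
  have h0 : ∫ g, ‖inner ℂ (U g v) y‖ ^ 2 ∂(normalizedHaar G) = 0 := by
    have h1 : ((∫ g, ‖inner ℂ (U g v) y‖ ^ 2 ∂(normalizedHaar G) : ℝ) : ℂ) = 0 := by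
      rw [← inner_zero_right y, ← hy, inner_averagedRankOne hU, ← integral_complex_ofReal]
      congr 1
      ext g
      rw [← inner_conj_symm y, Complex.mul_conj, Complex.normSq_eq_norm_sq]
    exact_mod_cast h1
  have horth : ∀ g, inner ℂ (U g v) y = 0 := by
    intro g
    by_contra hg
    have := hcont.integral_pos_of_hasCompactSupport_nonneg_nonzero
      (μ := normalizedHaar G) (x := g) (HasCompactSupport.of_compactSpace _)
      (fun g => by positivity) (by positivity)
    exact this.ne' h0
  have hmem : y ∈ (Submodule.span ℂ (Set.range fun g => U g v))ᗮ := by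
    rw [Submodule.mem_orthogonal]
    intro u hu
    induction hu using Submodule.span_induction with
    | mem x hx => obtain ⟨g, rfl⟩ := hx; exact horth g
    | zero => exact inner_zero_left _
    | add a b _ _ ha hb => rw [inner_add_left, ha, hb, add_zero]
    | smul a b _ hb => rw [inner_smul_left, hb, mul_zero]
  rwa [Submodule.topologicalClosure_eq_top_iff.1 hv, Submodule.mem_bot] at hmem

/-- In a cyclic unitary representation of a compact group, the vectors lying in finite-dimensional
invariant subspaces are dense. -/
theorem dense_setOf_mem_finiteDimensional_invariant {v : H}
    (hv : (Submodule.span ℂ (Set.range fun g => U g v)).topologicalClosure = ⊤) :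
    Dense {w : H | ∃ W : Submodule ℂ H, FiniteDimensional ℂ W ∧
      (∀ g, ∀ x ∈ W, U g x ∈ W) ∧ w ∈ W} := by
  set T := averagedRankOne U v
  have hfin : ∀ t : ℂ, FiniteDimensional ℂ (Module.End.eigenspace (T : Module.End ℂ H) t) := by
    intro t
    -- Compactness controls only nonzero eigenvalues; cyclicity rules out a kernel.
    by_cases ht : t = 0
    · have : Module.End.eigenspace (T : Module.End ℂ H) t = ⊥ := by
        rw [Submodule.eq_bot_iff]
        intro x hx
        rw [ht, Module.End.mem_eigenspace_iff, zero_smul] at hx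
        exact eq_zero_of_averagedRankOne_eq_zero hU hv hx
      rw [this]; infer_instance
    · exact ContinuousLinearMap.finite_dimensional_eigenspace
        (isCompactOperator_averagedRankOne hU v) t ht
  have hinv : ∀ t : ℂ, ∀ g, ∀ x ∈ Module.End.eigenspace (T : Module.End ℂ H) t,
      U g x ∈ Module.End.eigenspace (T : Module.End ℂ H) t := by
    intro t g x hx
    rw [Module.End.mem_eigenspace_iff] at hx ⊢
    refine (averagedRankOne_map hU v g x).trans ?_
    rw [← map_smul]
    exact congrArg (U g) hx
  have hdense : Dense ((⨆ t, Module.End.eigenspace (T : Module.End ℂ H) t : Submodule ℂ H) :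
      Set H) := by
    rw [Submodule.dense_iff_topologicalClosure_eq_top, Submodule.topologicalClosure_eq_top_iff]
    exact ContinuousLinearMap.orthogonalComplement_iSup_eigenspaces_eq_bot
      (isCompactOperator_averagedRankOne hU v) (isSymmetric_averagedRankOne hU v)
  refine hdense.mono fun w hw => ?_
  obtain ⟨s, hs⟩ := Submodule.mem_iSup_iff_exists_finset.1 hw
  refine ⟨⨆ t ∈ s, Module.End.eigenspace (T : Module.End ℂ H) t,
    Submodule.finiteDimensional_finset_sup s _ |> fun h => by rwa [Finset.sup_eq_iSup] at h,
    fun g x hx => ?_, hs⟩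
  have : (⨆ t ∈ s, Module.End.eigenspace (T : Module.End ℂ H) t) ≤
      (⨆ t ∈ s, Module.End.eigenspace (T : Module.End ℂ H) t).comap (U g).toLinearMap :=
    iSup₂_le fun t ht y hy => Submodule.mem_iSup_of_mem t
      (Submodule.mem_iSup_of_mem ht (hinv t g y hy))
  exact this hx

theorem integral_re_inner_add_nonneg {μ : Measure G} [IsFiniteMeasure μ] {c : ℝ}
    (hμ : ∀ (n : ℕ) (π : G →* Matrix.unitaryGroup (Fin n) ℂ), IsUnitaryIrrep π →
      (measureFourier μ π - (-(c : ℂ)) • (1 : Matrix (Fin n) (Fin n) ℂ)).PosSemidef)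
    {v : H} (hv : (Submodule.span ℂ (Set.range fun g => U g v)).topologicalClosure = ⊤) (w : H) :
    0 ≤ ∫ g, (inner ℂ w (U g w)).re ∂μ + c * ‖w‖ ^ 2 := by
  have hcl : IsClosed {w : H | 0 ≤ ∫ g, (inner ℂ w (U g w)).re ∂μ + c * ‖w‖ ^ 2} :=
    isClosed_le continuous_const
      ((continuous_integral_re_inner hU).add (continuous_const.mul (continuous_norm.pow 2)))
  refine hcl.closure_subset_iff.2 ?_ (dense_setOf_mem_finiteDimensional_invariant hU hv w)
  rintro x ⟨W, hWf, hW, hx⟩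
  exact integral_re_inner_add_nonneg_of_finiteDimensional hU hμ W hW hx

end

-- The GNS construction.

universe u

open UniformSpace in
theorem norm_completion_apply_of_isometry {X : Type*} [SeminormedAddCommGroup X]
    [InnerProductSpace ℂ X] (T : X →ₗᵢ[ℂ] X) (x : Completion X) :
    ‖T.toContinuousLinearMap.completion x‖ = ‖x‖ := by
  induction x using Completion.induction_on with
  | hp =>
    exact isClosed_eq
      (continuous_norm.comp T.toContinuousLinearMap.completion.continuous) continuous_norm
  | ih a => simp

open UniformSpace in
/-- An isometric linear action on a semi-inner product space extends to the completion. -/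
noncomputable def completionRep {G X : Type*} [Group G] [SeminormedAddCommGroup X] [InnerProductSpace ℂ X]
    (ρ : G →* (X →ₗᵢ[ℂ] X)) : G →* (Completion X →ₗᵢ[ℂ] Completion X) where
  toFun g :=
    ⟨((ρ g).toContinuousLinearMap.completion : Completion X →ₗ[ℂ] Completion X),
      norm_completion_apply_of_isometry (ρ g)⟩
  map_one' := by
    ext x
    induction x using Completion.induction_on with
    | hp => exact isClosed_eq (ContinuousLinearMap.continuous _) continuous_id
    | ih a => simp
  map_mul' g h := by
    ext x
    induction x using Completion.induction_on with
    | hp =>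
      exact isClosed_eq (ContinuousLinearMap.continuous _) (LinearIsometry.continuous _)
    | ih a => simp

theorem completionRep_coe {G X : Type*} [Group G] [SeminormedAddCommGroup X] [InnerProductSpace ℂ X]
    (ρ : G →* (X →ₗᵢ[ℂ] X)) (g : G) (x : X) :
    completionRep ρ g (x : UniformSpace.Completion X) = (ρ g x : X) :=
  ContinuousLinearMap.completion_apply_coe _ _

section
variable {G : Type*} [Group G] [TopologicalSpace G] {f : G → ℂ}

theorem IsPositiveDefiniteFun.finsupp_sum_nonneg (hf : IsPositiveDefiniteFun f) (a : G →₀ ℂ) :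
    0 ≤ a.sum fun x s => a.sum fun y t => star s * f (x⁻¹ * y) * t := by
  have h := hf.2 _ (fun i => (a.support.equivFin.symm i : G))
    (fun i => a (a.support.equivFin.symm i))
  simp only [Finsupp.sum]
  rw [← Finset.sum_coe_sort a.support, ← a.support.equivFin.symm.sum_comp]
  refine h.trans_eq (Finset.sum_congr rfl fun i _ => ?_)
  rw [← Finset.sum_coe_sort a.support, ← a.support.equivFin.symm.sum_comp]

theorem IsPositiveDefiniteFun.map_inv (hf : IsPositiveDefiniteFun f) (x : G) :
    f x⁻¹ = star (f x) := by
  -- The one-point test makes `f 1` real; coefficients `(1, 1)` and `(1, I)` then match the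
  -- imaginary and real parts.
  have h1 := hf.2 1 ![1] ![1]
  have h2 := hf.2 2 ![1, x] ![1, 1]
  have h3 := hf.2 2 ![1, x] ![1, Complex.I]
  simp [Fin.sum_univ_two, Complex.le_def] at h1 h2 h3
  refine Complex.ext ?_ ?_ <;> simp <;> linarith [h1.2, h2.2, h3.2]

/-- The positive semidefinite form on finitely supported functions attached to a positive definite
function. -/
@[reducible] noncomputable def positiveDefiniteCore (hf : IsPositiveDefiniteFun f) :
    PreInnerProductSpace.Core ℂ (G →₀ ℂ) where
  inner a b := a.sum fun x s => b.sum fun y t => star s * f (x⁻¹ * y) * t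
  conj_inner_symm a b := by
    rw [Finsupp.sum_comm]
    simp only [map_finsuppSum]
    refine Finset.sum_congr rfl fun x _ => Finset.sum_congr rfl fun y _ => ?_
    have := hf.map_inv (y⁻¹ * x)
    simp only [mul_inv_rev, inv_inv] at this
    simp [this, mul_comm, mul_left_comm]
  re_inner_nonneg a := (Complex.le_def.1 (hf.finsupp_sum_nonneg a)).1
  add_left a b d := by
    rw [Finsupp.sum_add_index'] <;> simp [add_mul, Finsupp.sum_add]
  smul_left a b s := by
    rw [Finsupp.sum_smul_index] <;> simp [Finsupp.mul_sum, mul_assoc]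

/-- Each `U g` is an isometry, so approximating `x` from the span of the orbit approximates `g ↦ U g
x` uniformly in `g`. -/
theorem continuous_orbit_of_cyclic {H : Type*} [NormedAddCommGroup H] [InnerProductSpace ℂ H]
    {U : G →* (H →ₗᵢ[ℂ] H)} {v : H} [IsTopologicalGroup G]
    (hv : (Submodule.span ℂ (Set.range fun g => U g v)).topologicalClosure = ⊤)
    (hc : Continuous fun g => U g v) (x : H) : Continuous fun g => U g x := by
  have hspan : ∀ y ∈ Submodule.span ℂ (Set.range fun g => U g v), Continuous fun g => U g y := by
    intro y hy
    induction hy using Submodule.span_induction with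
    | mem y hy =>
      obtain ⟨k, rfl⟩ := hy
      have : (fun g => U g (U k v)) = fun g => U (g * k) v := by ext g; rw [map_mul]; rfl
      rw [this]
      exact hc.comp (continuous_mul_const k)
    | zero => simpa using continuous_const
    | add a b _ _ ha hb => simp only [map_add]; exact ha.add hb
    | smul s a _ ha => simp only [map_smul]; exact ha.const_smul s
  refine continuous_of_uniform_approx_of_continuous fun u hu => ?_
  obtain ⟨ε, hε, hu⟩ := Metric.mem_uniformity_dist.1 hu
  have hx : x ∈ closure (Submodule.span ℂ (Set.range fun g => U g v) : Set H) := by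
    rw [← Submodule.topologicalClosure_coe, hv]; trivial
  obtain ⟨y, hy, hxy⟩ := Metric.mem_closure_iff.1 hx ε hε
  exact ⟨_, hspan y hy, fun g => hu (by rwa [(U g).dist_map])⟩

/-- The Gelfand–Naimark–Segal construction for a positive definite function on a topological
group. -/
theorem IsPositiveDefiniteFun.exists_cyclic_unitary {G : Type u} [Group G] [TopologicalSpace G]
    [IsTopologicalGroup G] {f : G → ℂ} (hf : IsPositiveDefiniteFun f) :
    ∃ (H : Type u) (_ : NormedAddCommGroup H) (_ : InnerProductSpace ℂ H) (_ : CompleteSpace H)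
      (U : G →* (H →ₗᵢ[ℂ] H)) (v : H), (∀ x, Continuous fun g => U g x) ∧
      (Submodule.span ℂ (Set.range fun g => U g v)).topologicalClosure = ⊤ ∧
      ∀ g, inner ℂ v (U g v) = f g := by
  let core := positiveDefiniteCore hf
  let : SeminormedAddCommGroup (G →₀ ℂ) :=
    InnerProductSpace.Core.toSeminormedAddCommGroup (𝕜 := ℂ)
  let : InnerProductSpace ℂ (G →₀ ℂ) := .ofCore core
  have hinner : ∀ a b : G →₀ ℂ,
      inner ℂ a b = a.sum fun x s => b.sum fun y t => star s * f (x⁻¹ * y) * t := fun _ _ => rfl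
  let L : G → (G →₀ ℂ) →ₗ[ℂ] (G →₀ ℂ) := fun g => Finsupp.lmapDomain ℂ ℂ (fun x => g * x)
  have hL : ∀ g a b, inner ℂ (L g a) (L g b) = inner ℂ a b := by
    intro g a b
    rw [hinner, hinner]
    simp only [L, Finsupp.lmapDomain_apply]
    rw [Finsupp.sum_mapDomain_index_inj (mul_right_injective g)]
    simp only [Finsupp.sum_mapDomain_index_inj (mul_right_injective g), mul_inv_rev, mul_assoc,
      inv_mul_cancel_left]
  let ρ : G →* ((G →₀ ℂ) →ₗᵢ[ℂ] (G →₀ ℂ)) :=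
    { toFun := fun g => ⟨L g, fun a => by
        rw [@norm_eq_sqrt_re_inner ℂ, @norm_eq_sqrt_re_inner ℂ, hL]⟩
      map_one' := by
        ext a : 1
        change Finsupp.mapDomain _ a = a
        simp only [one_mul]
        exact Finsupp.mapDomain_id
      map_mul' := fun g h => by
        ext a : 1
        change Finsupp.mapDomain _ a = Finsupp.mapDomain _ (Finsupp.mapDomain _ a)
        rw [← Finsupp.mapDomain_comp]
        congr 1
        ext x
        exact mul_assoc g h x }
  have hρ : ∀ g x, ρ g (Finsupp.single x 1) = Finsupp.single (g * x) 1 := fun g x =>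
    Finsupp.mapDomain_single
  -- The form may be degenerate; the Hausdorff completion also collapses null vectors.
  set U := completionRep ρ
  set v : UniformSpace.Completion (G →₀ ℂ) :=
    ((Finsupp.single 1 1 : G →₀ ℂ) : UniformSpace.Completion (G →₀ ℂ)) with hvdef
  have hUv : ∀ g, U g v = ((Finsupp.single g 1 : G →₀ ℂ) : UniformSpace.Completion (G →₀ ℂ)) := by
    intro g
    rw [hvdef, completionRep_coe, hρ, mul_one]
  have hcoef : ∀ g h, inner ℂ (U g v) (U h v) = f (g⁻¹ * h) := by
    intro g h
    rw [hUv, hUv, UniformSpace.Completion.inner_coe, hinner]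
    simp
  have hcyc : (Submodule.span ℂ (Set.range fun g => U g v)).topologicalClosure = ⊤ := by
    rw [← Submodule.dense_iff_topologicalClosure_eq_top]
    refine UniformSpace.Completion.denseRange_coe.mono ?_
    rintro _ ⟨a, rfl⟩
    have h1 : a ∈ Submodule.span ℂ (Set.range fun g : G => (Finsupp.single g 1 : G →₀ ℂ)) := by
      have := (Finsupp.basisSingleOne (R := ℂ) (ι := G)).span_eq
      rw [Finsupp.coe_basisSingleOne] at this
      rw [this]; trivial
    have h2 := Submodule.mem_map_of_mem
      (f := (UniformSpace.Completion.toComplL : (G →₀ ℂ) →L[ℂ] _).toLinearMap) h1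
    rw [Submodule.map_span, ← Set.range_comp] at h2
    have h3 : (fun g => U g v) = UniformSpace.Completion.toComplL (𝕜 := ℂ) ∘
        fun g : G => (Finsupp.single g 1 : G →₀ ℂ) := funext hUv
    rw [h3]
    exact h2
  have hcont : Continuous fun g => U g v := by
    rw [continuous_iff_continuousAt]
    intro g₀
    rw [ContinuousAt, tendsto_iff_norm_sub_tendsto_zero]
    have h1 : ∀ g, ‖U g v - U g₀ v‖ = √(2 * (f 1).re - 2 * (f (g⁻¹ * g₀)).re) := by
      intro g
      rw [← Real.sqrt_sq (norm_nonneg (U g v - U g₀ v)), @norm_sub_sq ℂ]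
      simp only [← @inner_self_eq_norm_sq ℂ, hcoef, inv_mul_cancel]
      congr 1
      simp only [RCLike.re_to_complex]
      ring
    simp only [h1]
    have h2 : Continuous fun g => √(2 * (f 1).re - 2 * (f (g⁻¹ * g₀)).re) := by
      have := hf.1
      fun_prop
    have h3 := h2.tendsto g₀
    simpa using h3
  refine ⟨UniformSpace.Completion (G →₀ ℂ), inferInstance, inferInstance, inferInstance, U, v,
    continuous_orbit_of_cyclic hcyc hcont, hcyc, fun g => ?_⟩
  have := hcoef 1 g
  rwa [map_one, inv_one, one_mul] at this

end

/-! ### Weak duality and the bound. -/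

theorem integral_nonpos_of_support_subset {G : Type*} [TopologicalSpace G]
    [MeasurableSpace G] [OpensMeasurableSpace G] {h : G → ℝ} (hcont : Continuous h) {B : Set G}
    (hB : ∀ g ∈ B, h g ≤ 0) {μ : Measure G} [μ.Regular] (hsupp : μ.support ⊆ closure B) :
    ∫ g, h g ∂μ ≤ 0 := by
  refine integral_nonpos_of_ae ?_
  filter_upwards [Measure.support_mem_ae_of_regular (μ := μ)] with g hg
  exact closure_minimal (t := {g | h g ≤ 0}) hB (isClosed_le hcont continuous_const) (hsupp hg)

section
attribute [local instance] isProbabilityMeasure_normalizedHaar isMulLeftInvariant_normalizedHaar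
variable {G : Type*} [Group G] [TopologicalSpace G] [IsTopologicalGroup G]
    [CompactSpace G] [MeasurableSpace G] [BorelSpace G]

/-- Weak duality against a measure whose Fourier coefficients are bounded below. -/
theorem integral_ge_of_isPositiveDefiniteFun {h : G → ℝ}
    (hpd : IsPositiveDefiniteFun (fun g => (h g : ℂ))) (hint : ∫ g, h g ∂(normalizedHaar G) = 1)
    {μ : Measure G} [IsProbabilityMeasure μ] {c : ℝ}
    (hμ : ∀ (n : ℕ) (π : G →* Matrix.unitaryGroup (Fin n) ℂ), IsUnitaryIrrep π →
      (measureFourier μ π - (-(c : ℂ)) • (1 : Matrix (Fin n) (Fin n) ℂ)).PosSemidef) :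
    1 - c * (h 1 - 1) ≤ ∫ g, h g ∂μ := by
  obtain ⟨H, _, _, _, U, v, hU, hv, hf⟩ := hpd.exists_cyclic_unitary
  have hcont : Continuous h := Complex.continuous_re.comp hpd.1
  set e : H := ∫ g, U g v ∂(normalizedHaar G) with he
  have hi : Integrable (fun g => U g v) (normalizedHaar G) := (hU v).integrable_of_compactSpace
  have hfix : ∀ x, U x e = e := by
    intro x
    have h1 := (U x).toContinuousLinearMap.integral_comp_comm hi
    have h2 := integral_mul_left_eq_self (μ := normalizedHaar G) (fun g => U g v) x
    simp only [map_mul] at h2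
    exact h1.symm.trans h2
  have hve : inner ℂ v e = (1 : ℂ) := by
    rw [he, ← integral_inner hi]
    simp only [hf]
    rw [integral_complex_ofReal, hint, Complex.ofReal_one]
  have hev : inner ℂ e v = (1 : ℂ) := by
    rw [← inner_conj_symm, hve, map_one]
  have heU : ∀ g, inner ℂ e (U g v) = (1 : ℂ) := fun g => by
    rw [← hfix g, LinearIsometry.inner_map_map, hev]
  -- Average the constant function `⟪e, U g v⟫ = 1` over the group.
  have hee : inner ℂ e e = (1 : ℂ) := by
    have h1 : ∫ g, inner ℂ e (U g v) ∂(normalizedHaar G) = (1 : ℂ) := by simp [heU]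
    rwa [integral_inner hi] at h1
  have hcoef : ∀ g, inner ℂ (v - e) (U g (v - e)) = ((h g - 1 : ℝ) : ℂ) := by
    intro g
    rw [map_sub, hfix, inner_sub_left, inner_sub_right, inner_sub_right, hf, hve, hee, heU]
    simp
  have hnorm : ‖v - e‖ ^ 2 = h 1 - 1 := by
    have h1 := hcoef 1
    rw [map_one, LinearIsometry.coe_one, id, inner_self_eq_norm_sq_to_K] at h1
    exact Complex.ofReal_injective (by simpa using h1)
  have key := integral_re_inner_add_nonneg hU hμ hv (v - e)
  simp only [hcoef, Complex.ofReal_re, hnorm] at key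
  rw [integral_sub hcont.integrable_of_compactSpace (integrable_const _)] at key
  rw [integral_const, probReal_univ, one_smul] at key
  linarith

end

theorem mainTheorem4 {G : Type*} [Group G] [TopologicalSpace G] [IsTopologicalGroup G]
    [CompactSpace G] [T2Space G] [MeasurableSpace G] [BorelSpace G]
    (A : Set G) (μ : Measure G) [IsProbabilityMeasure μ] [μ.Regular]
    (hsupp : μ.support ⊆ closure Aᶜ)
    (c : ℝ) (hc : 0 < c)
    (hμ : ∀ (n : ℕ) (π : G →* Matrix.unitaryGroup (Fin n) ℂ), IsUnitaryIrrep π →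
      (measureFourier μ π - (-(c : ℂ)) • (1 : Matrix (Fin n) (Fin n) ℂ)).PosSemidef) :
    ((1 + 1 / c : ℝ) : EReal) ≤ packingBound G A := by
  refine le_iInf₂ fun h ⟨hpd, hA, hint⟩ => EReal.coe_le_coe_iff.2 ?_
  have hcont : Continuous h := Complex.continuous_re.comp hpd.1
  have h1 := integral_ge_of_isPositiveDefiniteFun hpd hint hμ
  -- With `h1` this squeezes `1 - c * (h 1 - 1) ≤ ∫ h dμ ≤ 0`.
  have h2 := integral_nonpos_of_support_subset hcont hA hsupp
  have h3 : 1 / c ≤ h 1 - 1 := by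
    rw [div_le_iff₀ hc]
    linarith
  linarith
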